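/- Let $X$ be a complex Banach space with open unit ball $B_X$. For a complex Banach space $Y$ let $\mathcal HL_0(B_X,Y)$ be the space of bounded holomorphic Lipschitz maps $f\colon B_X\to Y$ with $f(0)=0$, normed by the Lipschitz constant $$L(f)=\sup\Big\{\tfrac{\|f(x)-f(y)\|}{\|x-y\|}:\ x\neq y\in B_X\Big\}$$ (with $\sup\emptyset=0$), and put $\mathcal HL_0(B_X)=\mathcal HL_0(B_X,\mathbb C)$. Let $\tau_0$ be the compact-open topology on $\mathcal HL_0(B_X)$ and let $\mathcal G_0(B_X)$, with the dual norm, be the space of those $\varphi\in\mathcal HL_0(B_X)^*$ whose restriction to the closed unit ball of $\mathcal HL_0(B_X)$ is $\tau_0$-continuous. For $x\in B_X$ let $\delta(x)\in\mathcal G_0(B_X)$ be the evaluation $\delta(x)(f)=f(x)$. Then $\mathcal G_0(B_X)$ is a Banach space, $\mathcal HL_0(B_X)$ is its dual, i.e. $f\mapsto(\varphi\mapsto\varphi(f))$ is an isometric isomorphism from $\mathcal HL_0(B_X)$ onto $\mathcal G_0(B_X)^*$, and the following hold. (a) The map $\delta\colon B_X\to\mathcal G_0(B_X)$ is holomorphic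 and $\|\delta(x)-\delta(y)\|=\|x-y\|$ for all $x,y\in B_X$. In particular $\delta\in\mathcal HL_0(B_X,\mathcal G_0(B_X))$, and $L(\delta)=1$ if $X\neq\{0\}$. (b) $\mathcal G_0(B_X)=\overline{\operatorname{span}}\{\delta(x):x\in B_X\}$, the closure being taken in $\mathcal HL_0(B_X)^*$. (c) For every complex Banach space $Y$ and every $f\in\mathcal HL_0(B_X,Y)$ there is a unique bounded linear operator $T_f\in\mathcal L(\mathcal G_0(B_X),Y)$ with $T_f\circ\delta=f$, and $f\mapsto T_f$ is an isometric isomorphism from $\mathcal HL_0(B_X,Y)$ onto $\mathcal L(\mathcal G_0(B_X),Y)$. These properties characterize $\mathcal G_0(B_X)$ up to isometric isomorphism: if $G$ is a complex Banach space and $d\colon B_X\to G$ is a map such that, for every complex Banach space $Y$, every $f\in\mathcal HL_0(B_X,Y)$ is $T\circ d$ for a unique $T\in\mathcal L(G,Y)$ and $f\mapsto T$ is an isometric isomorphism from $\mathcal HL_0(B_X,Y)$ onto $\mathcal L(G,Y)$, then there is a unique isometric linear isomorphism $e$ from $\mathcal G_0(B_X)$ onto $G$ with $e\circ\delta=d$.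 (d) A bounded net $(f_\alpha)$ in $\mathcal HL_0(B_X)$ converges to $f\in\mathcal HL_0(B_X)$ in the weak-star topology $\sigma(\mathcal HL_0(B_X),\mathcal G_0(B_X))$ if and only if $f_\alpha(x)\to f(x)$ for every $x\in B_X$. -/

import Mathlib

noncomputable section

namespace HolLip

/-- The open unit ball of `X`, as a type. -/
abbrev B (X : Type*) [NormedAddCommGroup X] : Type _ :=
  {x : X // x ∈ Metric.ball (0 : X) 1}

/-- The centre of the open unit ball. -/
def B.center (X : Type*) [NormedAddCommGroup X] : B X :=
  ⟨0, Metric.mem_ball_self one_pos⟩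

/-- A map defined on the open unit ball is holomorphic if it is complex Fréchet differentiable
at every point of the ball (`F` is any way of writing `f` as a function on `X`; its values off the
ball are irrelevant, the ball being open). -/
def IsHolomorphic {X Y : Type*} [NormedAddCommGroup X] [NormedSpace ℂ X]
    [NormedAddCommGroup Y] [NormedSpace ℂ Y] (f : B X → Y) : Prop :=
  ∃ F : X → Y, DifferentiableOn ℂ F (Metric.ball (0 : X) 1) ∧ ∀ x : B X, F x = f x

/-- `f` is Lipschitz with `f 0 = 0`. -/
def IsLip0 {X Y : Type*} [NormedAddCommGroup X] [NormedAddCommGroup Y] (f : B X → Y) : Prop :=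
  (∃ K : NNReal, LipschitzWith K f) ∧ f (B.center X) = 0

/-- `f` is holomorphic and bounded. -/
def IsHInf {X Y : Type*} [NormedAddCommGroup X] [NormedSpace ℂ X]
    [NormedAddCommGroup Y] [NormedSpace ℂ Y] (f : B X → Y) : Prop :=
  IsHolomorphic f ∧ ∃ C : ℝ, ∀ x, ‖f x‖ ≤ C

/-- The set of slopes of `f`, whose supremum is the Lipschitz constant `L(f)`. -/
def slopes {X Y : Type*} [NormedAddCommGroup X] [NormedAddCommGroup Y] (f : B X → Y) : Set ℝ :=
  {r | ∃ x y : B X, x ≠ y ∧ r = ‖f x - f y‖ / ‖(x : X) - (y : X)‖}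

/-- The Lipschitz constant `L(f)`, the supremum of the slopes (`0` if the ball is a point). -/
def lipConst {X Y : Type*} [NormedAddCommGroup X] [NormedAddCommGroup Y] (f : B X → Y) : ℝ :=
  sSup (slopes f)

theorem norm_sub_pos {X : Type*} [NormedAddCommGroup X] {x y : B X} (h : x ≠ y) : 0 < ‖(x : X) - (y : X)‖ :=
  norm_pos_iff.2 (sub_ne_zero.2 fun e => h (Subtype.ext e))

theorem lipConst_nonneg {X Y : Type*} [NormedAddCommGroup X] [NormedAddCommGroup Y]
    (f : B X → Y) : 0 ≤ lipConst f :=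
  Real.sSup_nonneg (by rintro r ⟨x, y, _, rfl⟩; positivity)

theorem lipConst_le {X Y : Type*} [NormedAddCommGroup X] [NormedAddCommGroup Y]
    {f : B X → Y} {C : ℝ} (hC : 0 ≤ C)
    (h : ∀ x y, ‖f x - f y‖ ≤ C * ‖(x : X) - (y : X)‖) : lipConst f ≤ C :=
  Real.sSup_le (by
    rintro r ⟨x, y, hxy, rfl⟩
    exact (div_le_iff₀ (norm_sub_pos hxy)).2 (h x y)) hC

section

variable (X Y : Type*) [NormedAddCommGroup X] [NormedSpace ℂ X]
  [NormedAddCommGroup Y] [NormedSpace ℂ Y]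

/-- `Lip₀(B_X, Y) ∩ H^∞(B_X, Y)` as a vector space of functions on the ball. -/
def HL0Submodule : Submodule ℂ (B X → Y) where
  carrier := {f | IsLip0 f ∧ IsHInf f}
  zero_mem' := ⟨⟨⟨0, LipschitzWith.const 0⟩, rfl⟩,
    ⟨0, differentiableOn_const 0, fun _ => rfl⟩, 0, fun _ => by simp⟩
  add_mem' := by
    rintro f g ⟨⟨⟨K, hK⟩, hf0⟩, ⟨F, hF, hFf⟩, C, hC⟩ ⟨⟨⟨K', hK'⟩, hg0⟩, ⟨G, hG, hGg⟩, C', hC'⟩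
    refine ⟨⟨⟨K + K', hK.add hK'⟩, by simp [hf0, hg0]⟩, ⟨F + G, hF.add hG, ?_⟩, C + C', ?_⟩
    · intro x; simp [hFf, hGg]
    · intro x; exact (norm_add_le _ _).trans (add_le_add (hC x) (hC' x))
  smul_mem' := by
    rintro c f ⟨⟨⟨K, hK⟩, hf0⟩, ⟨F, hF, hFf⟩, C, hC⟩
    refine ⟨⟨⟨‖c‖₊ * K, ?_⟩, by simp [hf0]⟩, ⟨c • F, hF.const_smul c, ?_⟩, ‖c‖ * C, ?_⟩
    · refine LipschitzWith.of_dist_le_mul fun x y => ?_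
      have h := hK.dist_le_mul x y
      rw [dist_eq_norm] at h ⊢
      have : (c • f) x - (c • f) y = c • (f x - f y) := by simp [smul_sub]
      rw [this, norm_smul, NNReal.coe_mul, coe_nnnorm, mul_assoc]
      exact mul_le_mul_of_nonneg_left h (norm_nonneg c)
    · intro x; simp [hFf]
    · intro x
      rw [Pi.smul_apply, norm_smul]
      exact mul_le_mul_of_nonneg_left (hC x) (norm_nonneg c)

/-- The space `HL₀(B_X, Y)` of holomorphic Lipschitz maps on the open unit ball of `X` that
vanish at the origin. It is a type of its own, so that its topology is the one of the norm `L(·)`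
defined below. -/
def HL0 : Type _ := HL0Submodule X Y

instance : AddCommGroup (HL0 X Y) := inferInstanceAs (AddCommGroup (HL0Submodule X Y))

instance : Module ℂ (HL0 X Y) := inferInstanceAs (Module ℂ (HL0Submodule X Y))

instance : FunLike (HL0 X Y) (B X) Y where
  coe f := f.1
  coe_injective _ _ h := Subtype.ext h

end

section

variable {X Y : Type*} [NormedAddCommGroup X] [NormedSpace ℂ X]
  [NormedAddCommGroup Y] [NormedSpace ℂ Y]

@[ext] theorem HL0.ext {f g : HL0 X Y} (h : ∀ x, f x = g x) : f = g := DFunLike.ext f g h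

@[simp] theorem HL0.zero_apply (x : B X) : (0 : HL0 X Y) x = 0 := rfl
@[simp] theorem HL0.add_apply (f g : HL0 X Y) (x : B X) : (f + g) x = f x + g x := rfl
@[simp] theorem HL0.neg_apply (f : HL0 X Y) (x : B X) : (-f) x = -f x := rfl
@[simp] theorem HL0.sub_apply (f g : HL0 X Y) (x : B X) : (f - g) x = f x - g x := rfl
@[simp] theorem HL0.smul_apply (c : ℂ) (f : HL0 X Y) (x : B X) : (c • f) x = c • f x := rfl

theorem HL0.mem (f : HL0 X Y) : IsLip0 (f : B X → Y) ∧ IsHInf (f : B X → Y) := f.2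

@[simp] theorem HL0.map_center (f : HL0 X Y) : f (B.center X) = 0 := f.mem.1.2

theorem HL0.continuous (f : HL0 X Y) : Continuous (f : B X → Y) :=
  let ⟨_, hK⟩ := f.mem.1.1
  hK.continuous

theorem HL0.bddAbove_slopes (f : HL0 X Y) : BddAbove (slopes (f : B X → Y)) := by
  obtain ⟨K, hK⟩ := f.mem.1.1
  refine ⟨K, ?_⟩
  rintro r ⟨x, y, hxy, rfl⟩
  have h := hK.dist_le_mul x y
  rw [dist_eq_norm, Subtype.dist_eq, dist_eq_norm] at h
  exact (div_le_iff₀ (norm_sub_pos hxy)).2 h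

theorem HL0.norm_sub_le (f : HL0 X Y) (x y : B X) :
    ‖f x - f y‖ ≤ lipConst (f : B X → Y) * ‖(x : X) - (y : X)‖ := by
  by_cases h : x = y
  · subst h; simp
  · exact (div_le_iff₀ (norm_sub_pos h)).1 (le_csSup f.bddAbove_slopes ⟨x, y, h, rfl⟩)

/-- `HL₀(B_X, Y)` is normed by the Lipschitz constant `L(·)`. -/
instance : NormedAddCommGroup (HL0 X Y) :=
  AddGroupNorm.toNormedAddCommGroup
    { toFun := fun f => lipConst (f : B X → Y)
      map_zero' := le_antisymm (lipConst_le le_rfl (by simp)) (lipConst_nonneg _)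
      add_le' := fun f g => by
        refine lipConst_le (add_nonneg (lipConst_nonneg _) (lipConst_nonneg _)) fun x y => ?_
        have e : (f + g) x - (f + g) y = (f x - f y) + (g x - g y) := by
          simp only [HL0.add_apply]; abel
        rw [e, add_mul]
        exact (norm_add_le _ _).trans (add_le_add (f.norm_sub_le x y) (g.norm_sub_le x y))
      neg' := fun f => by
        unfold lipConst slopes
        simp only [HL0.neg_apply, neg_sub_neg]
        refine congrArg sSup (Set.ext fun r => ⟨?_, ?_⟩)
        · rintro ⟨x, y, h, rfl⟩; exact ⟨x, y, h, by rw [norm_sub_rev (f x)]⟩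
        · rintro ⟨x, y, h, rfl⟩; exact ⟨x, y, h, by rw [norm_sub_rev (f x)]⟩
      eq_zero_of_map_eq_zero' := fun f hf => by
        ext x
        have h := f.norm_sub_le x (B.center X)
        have hf' : lipConst (f : B X → Y) = 0 := hf
        rw [hf', zero_mul, HL0.map_center, sub_zero] at h
        simpa using h }

theorem HL0.norm_def (f : HL0 X Y) : ‖f‖ = lipConst (f : B X → Y) := rfl

instance : NormedSpace ℂ (HL0 X Y) where
  norm_smul_le c f := by
    refine lipConst_le (mul_nonneg (norm_nonneg c) (lipConst_nonneg _)) fun x y => ?_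
    rw [HL0.smul_apply, HL0.smul_apply, ← smul_sub, norm_smul, mul_assoc]
    exact mul_le_mul_of_nonneg_left (f.norm_sub_le x y) (norm_nonneg c)

theorem HL0.norm_apply_le (f : HL0 X Y) (x : B X) : ‖f x‖ ≤ ‖(x : X)‖ * ‖f‖ := by
  have h := f.norm_sub_le x (B.center X)
  rw [HL0.map_center, sub_zero] at h
  have e : (x : X) - (B.center X : X) = x := sub_zero _
  rw [e, mul_comm] at h
  exact h

/-- The inclusion of `HL₀(B_X, Y)` into the continuous maps on the ball. -/
def HL0.toContinuousMap (f : HL0 X Y) : C(B X, Y) := ⟨f, f.continuous⟩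

end

/-- The compact-open topology `τ₀` on `HL₀(B_X, Y)`. -/
@[reducible] def tau0 (X Y : Type*) [NormedAddCommGroup X] [NormedSpace ℂ X]
    [NormedAddCommGroup Y] [NormedSpace ℂ Y] : TopologicalSpace (HL0 X Y) :=
  TopologicalSpace.induced HL0.toContinuousMap ContinuousMap.compactOpen

/-- The canonical predual `G₀(B_X)` as a subspace of the dual: the functionals in the dual of the normed space
`HL₀(B_X) = HL₀(B_X, ℂ)` whose restriction to the closed unit ball is `τ₀`-continuous. -/
def G0Submodule (X : Type*) [NormedAddCommGroup X] [NormedSpace ℂ X] :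
    Submodule ℂ (StrongDual ℂ (HL0 X ℂ)) where
  carrier := {φ | @ContinuousOn _ _ (tau0 X ℂ) _ (fun f => φ f)
    (Metric.closedBall (0 : HL0 X ℂ) 1)}
  zero_mem' := by
    let _ := tau0 X ℂ
    exact continuousOn_const
  add_mem' := fun {φ ψ} hφ hψ => by
    exact @ContinuousOn.add ℂ _ _ _ _ (tau0 X ℂ) (fun f => φ f) (fun f => ψ f) _ hφ hψ
  smul_mem' := fun c φ hφ => by
    exact @ContinuousOn.const_smul _ _ _ _ _ _ (tau0 X ℂ) (fun f => φ f) _ hφ c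

section

variable {X : Type*} [NormedAddCommGroup X] [NormedSpace ℂ X]

/-- The evaluation functional `f ↦ f x` in the dual of `HL₀(B_X)`. -/
def evalAt (x : B X) : StrongDual ℂ (HL0 X ℂ) :=
  LinearMap.mkContinuous
    { toFun := fun f => f x
      map_add' := fun _ _ => rfl
      map_smul' := fun _ _ => rfl } ‖(x : X)‖ fun f => f.norm_apply_le x

@[simp] theorem evalAt_apply (x : B X) (f : HL0 X ℂ) : evalAt x f = f x := rfl

theorem evalAt_mem (x : B X) : evalAt x ∈ G0Submodule X := by
  have h1 : @Continuous _ _ (tau0 X ℂ) _ (HL0.toContinuousMap : HL0 X ℂ → C(B X, ℂ)) :=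
    continuous_induced_dom
  have h2 : Continuous fun g : C(B X, ℂ) => g x := continuous_eval_const x
  have h3 : @Continuous _ _ (tau0 X ℂ) _ (fun f : HL0 X ℂ => f x) :=
    @Continuous.comp _ _ _ (tau0 X ℂ) _ _ HL0.toContinuousMap _ h2 h1
  exact @Continuous.continuousOn _ _ (tau0 X ℂ) _ _ _ h3

variable (X) in
/-- The canonical predual `G₀(B_X)`, a normed space with the norm of the dual of `HL₀(B_X)`. -/
def G0 : Type _ := G0Submodule X

instance : NormedAddCommGroup (G0 X) := inferInstanceAs (NormedAddCommGroup (G0Submodule X))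

instance : NormedSpace ℂ (G0 X) := inferInstanceAs (NormedSpace ℂ (G0Submodule X))

/-- The inclusion of `G₀(B_X)` into the dual of `HL₀(B_X)`. -/
def G0.incl : G0 X →ₗᵢ[ℂ] StrongDual ℂ (HL0 X ℂ) where
  toFun φ := φ.1
  map_add' _ _ := rfl
  map_smul' _ _ := rfl
  norm_map' _ := rfl

/-- The map `δ : B_X → G₀(B_X)`. -/
def delta (x : B X) : G0 X := ⟨evalAt x, evalAt_mem x⟩

@[simp] theorem incl_delta (x : B X) : G0.incl (delta x) = evalAt x := rfl

/-- A function `f ∈ HL₀(B_X)` seen as the functional `φ ↦ φ f` on `G₀(B_X)`. -/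
def pairing (f : HL0 X ℂ) : StrongDual ℂ (G0 X) :=
  LinearMap.mkContinuous
    { toFun := fun φ => G0.incl φ f
      map_add' := fun _ _ => rfl
      map_smul' := fun _ _ => rfl } ‖f‖ fun φ => by
    change ‖G0.incl φ f‖ ≤ ‖f‖ * ‖φ‖
    rw [mul_comm, ← G0.incl.norm_map φ]
    exact (G0.incl φ).le_opNorm f

@[simp] theorem pairing_apply (f : HL0 X ℂ) (φ : G0 X) : pairing f φ = G0.incl φ f := rfl

end

/-- The linearization property of a map `d : B_X → G`, for complex Banach spaces `Y`: every
`f ∈ HL₀(B_X, Y)` is `T ∘ d` for exactly one bounded operator `T : G → Y`, and `f ↦ T` is an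
isometric isomorphism from `HL₀(B_X, Y)` onto `L(G, Y)`. -/
def Linearizes.{u, w, v} {X : Type u} [NormedAddCommGroup X] [NormedSpace ℂ X]
    {G : Type w} [NormedAddCommGroup G] [NormedSpace ℂ G] (d : B X → G) : Prop :=
  ∀ (Y : Type v) [NormedAddCommGroup Y] [NormedSpace ℂ Y] [CompleteSpace Y],
    (∀ f : HL0 X Y, ∃! T : G →L[ℂ] Y, ∀ x, T (d x) = f x) ∧
    ∃ Λ : HL0 X Y ≃ₗᵢ[ℂ] (G →L[ℂ] Y), ∀ (f : HL0 X Y) (x : B X), Λ f (d x) = f x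

end HolLip

end

universe u v w t

noncomputable section

namespace HolLip

open Filter Topology Metric

/-! ### Extension by zero, operators on `HL0` and a uniform Taylor estimate. -/

section

variable {X Y Z : Type*} [NormedAddCommGroup X] [NormedAddCommGroup Y] [NormedAddCommGroup Z]

/-! Functions in the closed unit ball of `HL0 X ℂ` are 1-Lipschitz, so finite nets of compact sets
reduce `τ₀` there to pointwise convergence. A functional in `G0` is thus small on those that vanish
on a suitable finite set, and Hahn–Banach turns this into norm approximation by combinations of
evaluations (`exists_mem_span_evalAt`): `G0` is the closed span of the evaluations.

The map `δ` is holomorphic because a Schwarz estimate bounds Taylor remainders uniformly on bounded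
sets of functions (`HL0.norm_taylor_le`).

For `f` with values in `Y`, the operator `φ ↦ (ℓ ↦ φ (ℓ ∘ f))` sends evaluations into `Y` inside its
bidual, hence all of `G0` by density (`exists_linearization`). The case `Y = ℂ` is the duality; no
compactness of the unit ball is needed.

For uniqueness, the scalar case alone embeds any other `G` isometrically in the dual of `HL0 X ℂ`,
with `d x` going to `evalAt x`. Bounded weak-star convergence is again tested on the dense span. -/

theorem B.norm_le_one (x : B X) : ‖(x : X)‖ ≤ 1 :=
  (mem_ball_zero_iff.1 x.2).le

open Classical in
/-- The extension of a function on the ball by zero. -/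
def extend (f : B X → Y) (x : X) : Y :=
  if h : x ∈ ball (0 : X) 1 then f ⟨x, h⟩ else 0

theorem extend_coe (f : B X → Y) (x : B X) : extend f x = f x :=
  dif_pos x.2

theorem extend_add (f g : B X → Y) : extend (f + g) = extend f + extend g := by
  ext x
  by_cases h : x ∈ ball (0 : X) 1 <;> simp only [extend, h, dif_pos, dif_neg, Pi.add_apply,
    not_false_eq_true, add_zero]

variable [NormedSpace ℂ Y] [NormedSpace ℂ Z]

theorem extend_smul (c : ℂ) (f : B X → Y) : extend (c • f) = c • extend f := by
  ext x
  by_cases h : x ∈ ball (0 : X) 1 <;> simp only [extend, h, dif_pos, dif_neg, Pi.smul_apply,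
    not_false_eq_true, smul_zero]

theorem norm_clm_comp_sub_le (T : Y →L[ℂ] Z) {f : B X → Y} {C : ℝ}
    (h : ∀ x y, ‖f x - f y‖ ≤ C * ‖(x : X) - (y : X)‖) (x y : B X) :
    ‖T (f x) - T (f y)‖ ≤ ‖T‖ * C * ‖(x : X) - (y : X)‖ := by
  rw [← map_sub, mul_assoc]
  exact (T.le_opNorm _).trans (mul_le_mul_of_nonneg_left (h x y) (norm_nonneg T))

end

section

variable {X Y Z : Type*} [NormedAddCommGroup X] [NormedSpace ℂ X]
  [NormedAddCommGroup Y] [NormedSpace ℂ Y] [NormedAddCommGroup Z] [NormedSpace ℂ Z]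

theorem HL0.norm_le {f : HL0 X Y} {C : ℝ} (hC : 0 ≤ C)
    (h : ∀ x y, ‖f x - f y‖ ≤ C * ‖(x : X) - (y : X)‖) : ‖f‖ ≤ C :=
  lipConst_le hC h

theorem HL0.norm_sub_le_norm (f : HL0 X Y) (x y : B X) :
    ‖f x - f y‖ ≤ ‖f‖ * ‖(x : X) - (y : X)‖ :=
  f.norm_sub_le x y

/-- A holomorphic map on the ball that vanishes at the centre and is Lipschitz, as an element of
`HL₀(B_X, Y)`. -/
def HL0.mk (f : B X → Y) (hf : IsHolomorphic f) (h0 : f (B.center X) = 0) (C : ℝ) (hC : 0 ≤ C)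
    (h : ∀ x y, ‖f x - f y‖ ≤ C * ‖(x : X) - (y : X)‖) : HL0 X Y :=
  ⟨f, ⟨⟨⟨C, hC⟩, LipschitzWith.of_dist_le_mul fun x y => by
      rw [dist_eq_norm, Subtype.dist_eq, dist_eq_norm]; exact h x y⟩, h0⟩, hf, C, fun x => by
    have h1 := h x (B.center X)
    rw [h0, sub_zero, show ((B.center X : B X) : X) = 0 from rfl, sub_zero] at h1
    exact h1.trans (mul_le_of_le_one_right hC x.norm_le_one)⟩

theorem HL0.norm_mk_le (f : B X → Y) (hf : IsHolomorphic f) (h0 : f (B.center X) = 0)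
    (C : ℝ) (hC : 0 ≤ C) (h : ∀ x y, ‖f x - f y‖ ≤ C * ‖(x : X) - (y : X)‖) :
    ‖HL0.mk f hf h0 C hC h‖ ≤ C :=
  HL0.norm_le hC h

theorem IsHolomorphic.clm_comp (T : Y →L[ℂ] Z) {f : B X → Y} (hf : IsHolomorphic f) :
    IsHolomorphic fun x => T (f x) := by
  obtain ⟨F, hF, hFf⟩ := hf
  exact ⟨fun x => T (F x), T.differentiable.comp_differentiableOn hF, fun x => congrArg T (hFf x)⟩

/-- Composition of a map in `HL₀(B_X, Y)` with a bounded operator. -/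
def HL0.postcomp (T : Y →L[ℂ] Z) (f : HL0 X Y) : HL0 X Z :=
  HL0.mk (fun x => T (f x)) (f.mem.2.1.clm_comp T) (by simp) (‖T‖ * ‖f‖) (by positivity)
    (norm_clm_comp_sub_le T f.norm_sub_le_norm)

@[simp] theorem HL0.postcomp_apply (T : Y →L[ℂ] Z) (f : HL0 X Y) (x : B X) :
    f.postcomp T x = T (f x) := rfl

theorem HL0.norm_postcomp_le (T : Y →L[ℂ] Z) (f : HL0 X Y) : ‖f.postcomp T‖ ≤ ‖T‖ * ‖f‖ :=
  HL0.norm_mk_le _ _ _ _ _ _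

/-- The restriction of a bounded operator to the ball. -/
def HL0.ofCLM (T : X →L[ℂ] Y) : HL0 X Y :=
  HL0.mk (fun x => T x) ⟨T, T.differentiable.differentiableOn, fun _ => rfl⟩ (map_zero T)
    ‖T‖ (norm_nonneg T) fun x y => by rw [← map_sub]; exact T.le_opNorm _

@[simp] theorem HL0.ofCLM_apply (T : X →L[ℂ] Y) (x : B X) : HL0.ofCLM T x = T x := rfl

theorem HL0.norm_ofCLM_le (T : X →L[ℂ] Y) : ‖HL0.ofCLM T‖ ≤ ‖T‖ :=
  HL0.norm_mk_le _ _ _ _ _ _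

theorem IsHolomorphic.differentiableOn_extend {f : B X → Y} (hf : IsHolomorphic f) :
    DifferentiableOn ℂ (extend f) (ball (0 : X) 1) := by
  obtain ⟨F, hF, hFf⟩ := hf
  exact hF.congr fun x hx => (extend_coe f ⟨x, hx⟩).trans (hFf ⟨x, hx⟩).symm

theorem HL0.differentiableAt_extend (f : HL0 X Y) (x : B X) :
    DifferentiableAt ℂ (extend f) (x : X) :=
  f.mem.2.1.differentiableOn_extend.differentiableAt (isOpen_ball.mem_nhds x.2)

theorem HL0.norm_extend_sub_le (f : HL0 X Y) {x y : X} (hx : x ∈ ball (0 : X) 1)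
    (hy : y ∈ ball (0 : X) 1) : ‖extend f x - extend f y‖ ≤ ‖f‖ * ‖x - y‖ := by
  rw [extend_coe f ⟨x, hx⟩, extend_coe f ⟨y, hy⟩]
  exact f.norm_sub_le_norm _ _

theorem HL0.norm_fderiv_le (f : HL0 X Y) (x : B X) : ‖fderiv ℂ (extend f) (x : X)‖ ≤ ‖f‖ := by
  refine norm_fderiv_le_of_lip' ℂ (norm_nonneg f) ?_
  filter_upwards [isOpen_ball.mem_nhds x.2] with y hy
  exact f.norm_extend_sub_le hy x.2

/-- The first order Taylor remainder of a map in `HL₀(B_X, Y)` is bounded quadratically, uniformly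
on the bounded sets of `HL₀(B_X, Y)`. -/
theorem HL0.norm_taylor_le (f : HL0 X Y) (x : B X) {y : X}
    (hy : y ∈ ball (x : X) (1 - ‖(x : X)‖)) :
    ‖extend f y - extend f x - fderiv ℂ (extend f) (x : X) (y - x)‖ ≤
      2 * ‖f‖ / (1 - ‖(x : X)‖) * ‖y - x‖ ^ 2 := by
  set R := 1 - ‖(x : X)‖
  have hR : 0 < R := nonempty_ball.1 ⟨y, hy⟩
  have hsub : ball (x : X) R ⊆ ball (0 : X) 1 :=
    ball_subset_ball' (by simp [R])
  set L := fderiv ℂ (extend f) (x : X)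
  have hL : ‖L‖ ≤ ‖f‖ := f.norm_fderiv_le x
  set g : X → Y := fun z => extend f z - L (z - x) with hg
  have hgz : ∀ z, g z - g x = extend f z - extend f x - L (z - x) := fun z => by
    simp only [hg, sub_self, map_zero, sub_zero]; abel
  have hd : DifferentiableOn ℂ g (ball (x : X) R) :=
    (f.mem.2.1.differentiableOn_extend.mono hsub).sub
      (L.differentiable.comp (differentiable_id.sub_const _)).differentiableOn
  have hm : Set.MapsTo g (ball (x : X) R) (closedBall (g x) (2 * ‖f‖ * R)) := fun z hz => by
    rw [mem_closedBall, dist_eq_norm, hgz]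
    have h1 := f.norm_extend_sub_le (hsub hz) x.2
    have h2 : ‖L (z - x)‖ ≤ ‖f‖ * ‖z - x‖ :=
      (L.le_opNorm _).trans (mul_le_mul_of_nonneg_right hL (norm_nonneg _))
    have h3 : ‖f‖ * ‖z - (x : X)‖ ≤ ‖f‖ * R :=
      mul_le_mul_of_nonneg_left (mem_ball_iff_norm.1 hz).le (norm_nonneg f)
    linarith [_root_.norm_sub_le (extend (f : B X → Y) z - extend f (x : X)) (L (z - x))]
  -- With its linear part removed, `g - g x` vanishes to second order, so the higher-order Schwarz
  -- lemma gives the bound `2‖f‖R · (‖y - x‖ / R)²`.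
  have ho : (g · - g x) =o[𝓝 (x : X)] fun w => ‖w - x‖ ^ 1 := by
    simp only [hgz, pow_one]
    exact (f.differentiableAt_extend x).hasFDerivAt.isLittleO.norm_right
  have h := Complex.dist_le_mul_div_pow_of_mapsTo_ball_of_isLittleO hd hm ho hy
  rw [dist_eq_norm, dist_eq_norm, hgz] at h
  refine h.trans (le_of_eq ?_)
  rw [div_pow]
  field_simp

end

/-! ### `G0` is the closed span of the evaluations. -/

section

variable {X : Type*} [NormedAddCommGroup X] [NormedSpace ℂ X]

/-- Convergence in the dual norm is uniform on the unit ball, and uniform limits preserve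
`τ₀`-continuity there. -/
theorem isClosed_G0Submodule : IsClosed (G0Submodule X : Set (StrongDual ℂ (HL0 X ℂ))) := by
  refine isClosed_of_closure_subset fun φ hφ => ?_
  refine @continuousOn_of_uniform_approx_of_continuousOn _ _ (tau0 X ℂ) _ _ _ fun u hu => ?_
  obtain ⟨ε, hε, hεu⟩ := mem_uniformity_dist.1 hu
  obtain ⟨ψ, hψ, hφψ⟩ := Metric.mem_closure_iff.1 hφ ε hε
  refine ⟨fun f => ψ f, hψ, fun f hf => hεu ?_⟩
  rw [dist_eq_norm, ← _root_.sub_apply]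
  refine ((φ - ψ).le_of_opNorm_le_of_le le_rfl (mem_closedBall_zero_iff.1 hf)).trans_lt ?_
  rwa [mul_one, ← dist_eq_norm]

instance : CompleteSpace (G0 X) :=
  isClosed_G0Submodule.completeSpace_coe

/-- A functional that is `τ₀`-continuous on the unit ball is small at the functions in the ball that
vanish on a suitable finite set. -/
theorem exists_finset_norm_apply_le {φ : StrongDual ℂ (HL0 X ℂ)} (hφ : φ ∈ G0Submodule X)
    {ε : ℝ} (hε : 0 < ε) :
    ∃ s : Finset (B X), ∀ f ∈ closedBall (0 : HL0 X ℂ) 1, (∀ x ∈ s, f x = 0) → ‖φ f‖ ≤ ε := by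
  have h0 : @ContinuousWithinAt _ _ (tau0 X ℂ) _ (fun f => φ f)
    (closedBall (0 : HL0 X ℂ) 1) 0 := hφ 0 (by simp)
  have h1 : {f : HL0 X ℂ | ‖φ f‖ < ε} ∈ @nhdsWithin _ (tau0 X ℂ) 0 (closedBall (0 : HL0 X ℂ) 1) := by
    have := h0 (show ball (0 : ℂ) ε ∈ 𝓝 (φ 0) by rw [map_zero]; exact ball_mem_nhds 0 hε)
    simpa only [mem_map, Set.preimage, mem_ball_zero_iff] using this
  obtain ⟨U, hU, hUs⟩ := (@mem_nhdsWithin_iff_exists_mem_nhds_inter _ (tau0 X ℂ) _ _ _).1 h1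
  rw [nhds_induced] at hU
  obtain ⟨V, hV, hVU⟩ := hU
  obtain ⟨⟨K, r⟩, ⟨hK, hr⟩, hKr⟩ := (nhds_basis_uniformity
    (uniformity_basis_dist (α := ℂ)).compactConvergenceUniformity).mem_iff.1 hV
  -- A finite `r`-net of `K` suffices: a 1-Lipschitz function vanishing on it is smaller than `r` on
  -- all of `K`.
  obtain ⟨t, -, ht, hKt⟩ := hK.finite_cover_balls hr
  refine ⟨ht.toFinset, fun f hf hft => (hUs ⟨hVU (hKr fun x hx => ?_), hf⟩).le⟩
  obtain ⟨y, hy, hxy⟩ := Set.mem_iUnion₂.1 (hKt hx)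
  have h2 := f.norm_sub_le_norm x y
  rw [hft y (ht.mem_toFinset.2 hy), sub_zero] at h2
  change dist (f x) 0 < r
  rw [dist_zero_right]
  refine (h2.trans (mul_le_of_le_one_left (norm_nonneg _) (mem_closedBall_zero_iff.1 hf))).trans_lt ?_
  rwa [← dist_eq_norm, ← Subtype.dist_eq]

/-- Every element of `G₀(B_X)` is within any `ε > 0` of a linear combination of evaluations. -/
theorem exists_mem_span_evalAt {φ : StrongDual ℂ (HL0 X ℂ)} (hφ : φ ∈ G0Submodule X)
    {ε : ℝ} (hε : 0 < ε) :
    ∃ ψ ∈ Submodule.span ℂ (Set.range (evalAt : B X → StrongDual ℂ (HL0 X ℂ))),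
      ‖φ - ψ‖ ≤ ε := by
  obtain ⟨s, hs⟩ := exists_finset_norm_apply_le hφ hε
  let N : Submodule ℂ (HL0 X ℂ) := ⨅ x : s, (evalAt (x : B X)).toLinearMap.ker
  have hN : ∀ f ∈ N, ∀ x ∈ s, f x = 0 := fun f hf x hx =>
    (Submodule.mem_iInf _).1 hf ⟨x, hx⟩
  -- The restriction of `φ` to `N` has norm at most `ε`, and so has its extension `φ'`. The
  -- difference `φ - φ'` kills a finite intersection of kernels of evaluations, hence is a
  -- combination of them.
  obtain ⟨φ', hφ', hn⟩ := exists_extension_norm_eq N (φ.comp N.subtypeL)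
  have hle : ‖φ.comp N.subtypeL‖ ≤ ε := by
    refine ContinuousLinearMap.opNorm_le_of_unit_norm hε.le fun f hf => ?_
    exact hs f (by simpa using hf.le) (hN f f.2)
  have hker : N ≤ (φ - φ').toLinearMap.ker := fun f hf => by
    change φ f - φ' f = 0
    rw [sub_eq_zero]
    exact (hφ' ⟨f, hf⟩).symm
  have hmem := mem_span_of_iInf_ker_le_ker hker
  refine ⟨φ - φ', ?_, by rw [sub_sub_cancel, hn]; exact hle⟩
  have hmap : Submodule.span ℂ (Set.range fun x : s => (evalAt (x : B X)).toLinearMap) =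
      (Submodule.span ℂ (Set.range fun x : s => evalAt (x : B X))).map
        (ContinuousLinearMap.coeLM ℂ) := by
    rw [Submodule.map_span, ← Set.range_comp]; rfl
  rw [hmap] at hmem
  obtain ⟨ψ, hψ, hψe⟩ := hmem
  rw [← ContinuousLinearMap.coe_injective hψe]
  exact Submodule.span_mono (by rintro _ ⟨x, rfl⟩; exact ⟨x, rfl⟩) hψ

theorem G0Submodule_eq_topologicalClosure : G0Submodule X =
    (Submodule.span ℂ (Set.range (evalAt : B X → StrongDual ℂ (HL0 X ℂ)))).topologicalClosure := by
  refine le_antisymm (fun φ hφ => ?_) (Submodule.topologicalClosure_minimal _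
    (Submodule.span_le.2 ?_) isClosed_G0Submodule)
  · refine Metric.mem_closure_iff.2 fun ε hε => ?_
    obtain ⟨ψ, hψ, h⟩ := exists_mem_span_evalAt hφ (half_pos hε)
    exact ⟨ψ, hψ, by rw [dist_eq_norm]; linarith⟩
  · rintro _ ⟨x, rfl⟩
    exact evalAt_mem x

theorem dense_span_delta :
    Dense (Submodule.span ℂ (Set.range (delta : B X → G0 X)) : Set (G0 X)) := by
  refine Metric.dense_iff.2 fun φ ε hε => ?_
  obtain ⟨ψ, hψ, h⟩ := exists_mem_span_evalAt φ.2 (half_pos hε)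
  have hmap : Submodule.span ℂ (Set.range (evalAt : B X → StrongDual ℂ (HL0 X ℂ))) =
      (Submodule.span ℂ (Set.range (delta : B X → G0 X))).map G0.incl.toLinearMap := by
    rw [Submodule.map_span, ← Set.range_comp]; rfl
  rw [hmap] at hψ
  obtain ⟨ψ, hψ', rfl⟩ := hψ
  refine ⟨ψ, ?_, hψ'⟩
  rw [mem_ball_iff_norm, norm_sub_rev, ← G0.incl.norm_map, map_sub]
  exact lt_of_le_of_lt h (half_lt_self hε)

/-- A closed subspace of `G₀(B_X)` that contains the evaluations is everything. -/
theorem G0.induction (M : Submodule ℂ (G0 X)) (hM : IsClosed (M : Set (G0 X)))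
    (h : ∀ x, delta x ∈ M) (φ : G0 X) : φ ∈ M :=
  closure_minimal (SetLike.coe_subset_coe.2 (Submodule.span_le.2 (Set.range_subset_iff.2 h))) hM
    (dense_span_delta φ)

/-! ### The map `δ`: isometry and holomorphy. -/

theorem norm_delta_sub (x y : B X) : ‖delta x - delta y‖ = ‖(x : X) - (y : X)‖ := by
  rw [← G0.incl.norm_map, map_sub, incl_delta, incl_delta]
  refine le_antisymm (ContinuousLinearMap.opNorm_le_bound _ (norm_nonneg _) fun f => ?_) ?_
  · rw [mul_comm]
    exact f.norm_sub_le_norm x y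
  -- A functional norming `x - y`, restricted to the ball, is a test function with Lipschitz
  -- constant at most 1.
  · obtain ⟨ℓ, hℓ, hℓxy⟩ := exists_dual_vector'' ℂ ((x : X) - (y : X))
    have h := (evalAt x - evalAt y).le_of_opNorm_le_of_le le_rfl ((HL0.norm_ofCLM_le ℓ).trans hℓ)
    rw [mul_one, _root_.sub_apply, evalAt_apply, evalAt_apply, HL0.ofCLM_apply, HL0.ofCLM_apply,
      ← map_sub, hℓxy] at h
    simpa using h

@[simp] theorem delta_center : delta (B.center X) = 0 :=
  G0.incl.injective (by ext f; simp)

/-- The functionals `f ↦ f'(x) h`, as an operator in `h`. -/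
def derivEvalAt (x : B X) : X →L[ℂ] StrongDual ℂ (HL0 X ℂ) :=
  LinearMap.mkContinuous₂
    (LinearMap.mk₂ ℂ (fun h (f : HL0 X ℂ) => fderiv ℂ (extend f) (x : X) h)
      (fun _ _ _ => map_add _ _ _) (fun _ _ _ => map_smul _ _ _)
      (fun h f g => by
        change fderiv ℂ (extend ((f : B X → ℂ) + (g : B X → ℂ))) (x : X) h = _
        rw [extend_add, fderiv_add (f.differentiableAt_extend x) (g.differentiableAt_extend x)]
        rfl)
      (fun c h f => by
        change fderiv ℂ (extend (c • (f : B X → ℂ))) (x : X) h = _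
        rw [extend_smul, fderiv_const_smul (f.differentiableAt_extend x)]
        rfl))
    1 fun h f => by
      rw [one_mul, mul_comm]
      exact (fderiv ℂ (extend f) (x : X)).le_of_opNorm_le (f.norm_fderiv_le x) h

@[simp] theorem derivEvalAt_apply (x : B X) (h : X) (f : HL0 X ℂ) :
    derivEvalAt x h f = fderiv ℂ (extend f) (x : X) h := rfl

theorem extend_evalAt_apply (y : X) (f : HL0 X ℂ) : extend evalAt y f = extend f y := by
  unfold extend
  split_ifs <;> rfl

theorem incl_extend_delta (y : X) : G0.incl (extend delta y) = extend evalAt y := by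
  unfold extend
  split_ifs <;> rfl

/-- The quadratic remainder bound is linear in `‖f‖`, so it bounds the remainder in the dual norm.
-/
theorem hasFDerivAt_extend_evalAt (x : B X) :
    HasFDerivAt (extend (evalAt : B X → StrongDual ℂ (HL0 X ℂ))) (derivEvalAt x) (x : X) := by
  have hR : 0 < 1 - ‖(x : X)‖ := sub_pos.2 (mem_ball_zero_iff.1 x.2)
  refine .of_isLittleO ?_
  have hO : (fun y : X => extend (evalAt : B X → StrongDual ℂ (HL0 X ℂ)) y - extend evalAt (x : X) -
      derivEvalAt x (y - x)) =O[𝓝 (x : X)] fun y => ‖y - x‖ ^ 2 := by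
    refine .of_bound (2 / (1 - ‖(x : X)‖)) ?_
    filter_upwards [ball_mem_nhds (x : X) hR] with y hy
    rw [norm_pow, norm_norm]
    refine ContinuousLinearMap.opNorm_le_bound _ (by positivity) fun f => ?_
    simp only [_root_.sub_apply, extend_evalAt_apply, derivEvalAt_apply]
    refine (f.norm_taylor_le x hy).trans (le_of_eq ?_)
    ring
  refine hO.trans_isLittleO ?_
  exact Asymptotics.isLittleO_pow_sub_sub (x : X) one_lt_two

theorem derivEvalAt_mem (x : B X) (h : X) : derivEvalAt x h ∈ G0Submodule X := by
  have ht := ((hasFDerivAt_extend_evalAt x).hasLineDerivAt h).tendsto_slope_zero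
  -- No restriction on `t` is needed: off the ball the extension is 0, which also lies in `G0`.
  refine isClosed_G0Submodule.mem_of_tendsto ht (Eventually.of_forall fun t => ?_)
  rw [← incl_extend_delta, ← incl_extend_delta, ← map_sub, ← map_smul]
  exact Subtype.property _

theorem isHolomorphic_delta : IsHolomorphic (delta : B X → G0 X) := by
  refine ⟨extend delta, fun x hx => ?_, extend_coe _⟩
  let D : X →L[ℂ] G0 X :=
    (derivEvalAt ⟨x, hx⟩).codRestrict (G0Submodule X) (derivEvalAt_mem ⟨x, hx⟩)
  have hD : HasFDerivAt (extend delta) D x := by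
    refine .of_isLittleO (.of_norm_left ?_)
    have h := (hasFDerivAt_extend_evalAt ⟨x, hx⟩).isLittleO.norm_left
    refine h.congr_left fun y => ?_
    rw [← G0.incl.norm_map, G0.incl.map_sub, G0.incl.map_sub, incl_extend_delta,
      incl_extend_delta]
    rfl
  exact hD.differentiableAt.differentiableWithinAt

/-- The map `δ` as an element of `HL₀(B_X, G₀(B_X))`. -/
def HL0.delta : HL0 X (G0 X) :=
  HL0.mk HolLip.delta isHolomorphic_delta delta_center 1 zero_le_one fun x y => by
    rw [norm_delta_sub, one_mul]

@[simp] theorem HL0.delta_apply (x : B X) : (HL0.delta : HL0 X (G0 X)) x = HolLip.delta x := rfl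

theorem HL0.norm_delta_le : ‖(HL0.delta : HL0 X (G0 X))‖ ≤ 1 :=
  HL0.norm_mk_le _ _ _ _ _ _

theorem HL0.norm_delta [Nontrivial X] : ‖(HL0.delta : HL0 X (G0 X))‖ = 1 := by
  refine le_antisymm HL0.norm_delta_le ?_
  -- Any nonzero point of the ball would do; compare it with the centre.
  obtain ⟨v, hv⟩ := exists_norm_eq X (c := 1 / 2) (by norm_num)
  have h := HL0.delta.norm_sub_le_norm
    ⟨v, mem_ball_zero_iff.2 (hv.trans_lt one_half_lt_one)⟩ (B.center X)
  rw [HL0.delta_apply, HL0.delta_apply, norm_delta_sub, show ((B.center X : B X) : X) = 0 from rfl,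
    sub_zero, hv] at h
  linarith

end

/-! ### Linearization of vector-valued maps through `δ`. -/

section

variable {X Y Z : Type*} [NormedAddCommGroup X] [NormedSpace ℂ X]
  [NormedAddCommGroup Y] [NormedSpace ℂ Y] [NormedAddCommGroup Z] [NormedSpace ℂ Z]

theorem ext_delta {T S : G0 X →L[ℂ] Y} (h : ∀ x, T (delta x) = S (delta x)) : T = S :=
  ContinuousLinearMap.ext_on dense_span_delta (by rintro _ ⟨x, rfl⟩; exact h x)

theorem HL0.postcomp_add (ℓ ℓ' : Y →L[ℂ] Z) (f : HL0 X Y) :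
    f.postcomp (ℓ + ℓ') = f.postcomp ℓ + f.postcomp ℓ' := rfl

theorem HL0.postcomp_smul (c : ℂ) (ℓ : Y →L[ℂ] Z) (f : HL0 X Y) :
    f.postcomp (c • ℓ) = c • f.postcomp ℓ := rfl

theorem norm_incl_postcomp_le (f : HL0 X Y) (φ : G0 X) (ℓ : StrongDual ℂ Y) :
    ‖G0.incl φ (f.postcomp ℓ)‖ ≤ ‖f‖ * ‖φ‖ * ‖ℓ‖ := by
  refine ((G0.incl φ).le_of_opNorm_le_of_le le_rfl (f.norm_postcomp_le ℓ)).trans (le_of_eq ?_)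
  rw [G0.incl.norm_map]
  ring

/-- The map `φ ↦ (ℓ ↦ φ (ℓ ∘ f))` from `G₀(B_X)` to the bidual of `Y`. -/
def toBidual (f : HL0 X Y) : G0 X →L[ℂ] StrongDual ℂ (StrongDual ℂ Y) :=
  LinearMap.mkContinuous₂
    (LinearMap.mk₂ ℂ (fun (φ : G0 X) (ℓ : StrongDual ℂ Y) => G0.incl φ (f.postcomp ℓ))
      (fun _ _ _ => rfl) (fun _ _ _ => rfl)
      (fun φ ℓ ℓ' => by rw [HL0.postcomp_add, map_add])
      (fun c φ ℓ => by rw [HL0.postcomp_smul, map_smul]))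
    ‖f‖ (norm_incl_postcomp_le f)

theorem norm_toBidual_apply_le (f : HL0 X Y) (φ : G0 X) : ‖toBidual f φ‖ ≤ ‖f‖ * ‖φ‖ :=
  ContinuousLinearMap.opNorm_le_bound _ (by positivity) fun ℓ =>
    norm_incl_postcomp_le f φ ℓ

/-- Every map in `HL₀(B_X, Y)`, for a Banach space `Y`, factors through `δ`. -/
theorem exists_linearization [CompleteSpace Y] (f : HL0 X Y) :
    ∃ T : G0 X →L[ℂ] Y, (∀ x, T (delta x) = f x) ∧ ‖T‖ ≤ ‖f‖ := by
  let ι := NormedSpace.inclusionInDoubleDualLi ℂ (E := Y)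
  -- Completeness of `Y` enters here: `Y` is closed in its bidual, so membership need only be
  -- checked on evaluations.
  have hcl : IsClosed (LinearMap.range ι.toLinearMap : Set (StrongDual ℂ (StrongDual ℂ Y))) := by
    exact ι.isometry.isUniformInducing.isComplete_range.isClosed
  have hmem : ∀ φ, toBidual f φ ∈ LinearMap.range ι.toLinearMap :=
    G0.induction ((LinearMap.range ι.toLinearMap).comap (toBidual f).toLinearMap)
      (hcl.preimage (toBidual f).continuous) fun x => ⟨f x, rfl⟩
  let T : G0 X →ₗ[ℂ] Y := (LinearEquiv.ofInjective ι.toLinearMap ι.injective).symm.toLinearMap ∘ₗ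
    (toBidual f).toLinearMap.codRestrict (LinearMap.range ι.toLinearMap) hmem
  have hT : ∀ φ, ι (T φ) = toBidual f φ := fun φ =>
    congrArg Subtype.val ((LinearEquiv.ofInjective ι.toLinearMap ι.injective).apply_symm_apply _)
  have hle : ∀ φ, ‖T φ‖ ≤ ‖f‖ * ‖φ‖ := fun φ => by
    rw [← ι.norm_map, hT]
    exact norm_toBidual_apply_le f φ
  exact ⟨T.mkContinuous ‖f‖ hle, fun x => ι.injective (hT (delta x)),
    T.mkContinuous_norm_le (norm_nonneg f) hle⟩

/-- The space `HL₀(B_X, Y)` is isometrically isomorphic to `L(G₀(B_X), Y)` by `T ↦ T ∘ δ`. -/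
def linearizationEquiv (X Y : Type*) [NormedAddCommGroup X] [NormedSpace ℂ X]
    [NormedAddCommGroup Y] [NormedSpace ℂ Y] [CompleteSpace Y] :
    (G0 X →L[ℂ] Y) ≃ₗᵢ[ℂ] HL0 X Y :=
  LinearIsometryEquiv.ofSurjective
    { toFun := fun T => HL0.delta.postcomp T
      map_add' := fun _ _ => rfl
      map_smul' := fun _ _ => rfl
      norm_map' := fun T => by
        refine le_antisymm ((HL0.norm_postcomp_le T _).trans
          (mul_le_of_le_one_right (norm_nonneg T) HL0.norm_delta_le)) ?_
        -- By density the factorization `S` of `T ∘ δ` is `T` itself, so its norm bound is the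
        -- missing inequality.
        obtain ⟨S, hS, hle⟩ := exists_linearization (HL0.delta.postcomp T)
        rwa [ext_delta hS] at hle }
    fun f => by
      obtain ⟨T, hT, -⟩ := exists_linearization f
      exact ⟨T, HL0.ext hT⟩

@[simp] theorem linearizationEquiv_apply [CompleteSpace Y] (T : G0 X →L[ℂ] Y) (x : B X) :
    linearizationEquiv X Y T x = T (delta x) := rfl

@[simp] theorem linearizationEquiv_symm_delta [CompleteSpace Y] (f : HL0 X Y) (x : B X) :
    (linearizationEquiv X Y).symm f (delta x) = f x := by
  rw [← linearizationEquiv_apply, LinearIsometryEquiv.apply_symm_apply]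

theorem linearizationEquiv_symm_eq_pairing (f : HL0 X ℂ) :
    (linearizationEquiv X ℂ).symm f = pairing f :=
  ext_delta fun x => by rw [linearizationEquiv_symm_delta]; rfl

/-! ### The universal property and uniqueness of the predual. -/

theorem linearizes_delta {X : Type u} [NormedAddCommGroup X] [NormedSpace ℂ X] :
    Linearizes.{u, u, v} (delta : B X → G0 X) := fun Y _ _ _ =>
  ⟨fun f => ⟨(linearizationEquiv X Y).symm f, linearizationEquiv_symm_delta f,
    fun _ hT => ext_delta fun x => (hT x).trans (linearizationEquiv_symm_delta f x).symm⟩,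
    (linearizationEquiv X Y).symm, linearizationEquiv_symm_delta⟩

/-- The linearization property, with scalar values and without change of universe. -/
theorem Linearizes.exists_scalar {X : Type u} [NormedAddCommGroup X] [NormedSpace ℂ X]
    {G : Type w} [NormedAddCommGroup G] [NormedSpace ℂ G] {d : B X → G}
    (hd : Linearizes.{u, w, v} d) :
    ∃ Λ : HL0 X ℂ ≃ₗᵢ[ℂ] StrongDual ℂ G, (∀ f x, Λ f (d x) = f x) ∧
      ∀ T S : StrongDual ℂ G, (∀ x, T (d x) = S (d x)) → T = S := by
  -- The hypothesis speaks of targets in universe `v`, so it is applied to a lifted copy of `ℂ` and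
  -- carried back by contractions.
  let U : ULift.{v} ℂ ≃ₗᵢ[ℂ] ℂ := LinearIsometryEquiv.ulift ℂ ℂ
  let up : ℂ →L[ℂ] ULift.{v} ℂ := U.symm.toContinuousLinearEquiv.toContinuousLinearMap
  let down : ULift.{v} ℂ →L[ℂ] ℂ := U.toContinuousLinearEquiv.toContinuousLinearMap
  have hup : ‖up‖ ≤ 1 := U.symm.toLinearIsometry.norm_toContinuousLinearMap_le
  have hdown : ‖down‖ ≤ 1 := U.toLinearIsometry.norm_toContinuousLinearMap_le
  obtain ⟨huniq, Λ, hΛ⟩ := hd (ULift.{v} ℂ)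
  have hext : ∀ T S : StrongDual ℂ G, (∀ x, T (d x) = S (d x)) → T = S := fun T S h => by
    have h1 : up.comp T = up.comp S := (huniq (Λ.symm (up.comp S))).unique
      (fun x => by
        rw [← hΛ, Λ.apply_symm_apply]; exact congrArg up (h x))
      (fun x => by rw [← hΛ, Λ.apply_symm_apply])
    ext g
    exact U.symm.injective (DFunLike.congr_fun h1 g)
  have hle : ∀ f : HL0 X ℂ, ‖down.comp (Λ (f.postcomp up))‖ ≤ ‖f‖ := fun f => by
    refine (down.opNorm_comp_le _).trans ((mul_le_of_le_one_left (norm_nonneg _) hdown).trans ?_)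
    rw [Λ.norm_map]
    exact (f.norm_postcomp_le up).trans (mul_le_of_le_one_left (norm_nonneg _) hup)
  let Φ : HL0 X ℂ →ₗᵢ[ℂ] StrongDual ℂ G :=
    { toFun := fun f => down.comp (Λ (f.postcomp up))
      map_add' := fun f g => by
        have : (f + g).postcomp up = f.postcomp up + g.postcomp up := HL0.ext fun _ => rfl
        rw [this, map_add, ContinuousLinearMap.comp_add]
      map_smul' := fun c f => by
        have : (c • f).postcomp up = c • f.postcomp up := HL0.ext fun _ => rfl
        rw [this, map_smul, ContinuousLinearMap.comp_smul, RingHom.id_apply]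
      norm_map' := fun f => by
        refine le_antisymm (hle f) ?_
        have hf : f = (Λ.symm (up.comp (down.comp (Λ (f.postcomp up))))).postcomp down :=
          HL0.ext fun x => by
            rw [HL0.postcomp_apply, ← hΛ, Λ.apply_symm_apply]
            exact congrArg down (hΛ (f.postcomp up) x).symm
        calc ‖f‖ ≤ ‖down‖ * ‖Λ.symm (up.comp (down.comp (Λ (f.postcomp up))))‖ :=
              (congrArg norm hf).trans_le (HL0.norm_postcomp_le _ _)
          _ ≤ ‖up.comp (down.comp (Λ (f.postcomp up)))‖ := by
              rw [Λ.symm.norm_map]; exact mul_le_of_le_one_left (norm_nonneg _) hdown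
          _ ≤ ‖down.comp (Λ (f.postcomp up))‖ :=
              (up.opNorm_comp_le _).trans (mul_le_of_le_one_left (norm_nonneg _) hup) }
  have hΦ : ∀ f x, Φ f (d x) = f x := fun f x => congrArg down (hΛ (f.postcomp up) x)
  refine ⟨.ofSurjective Φ fun T => ⟨(Λ.symm (up.comp T)).postcomp down, hext _ _ fun x => ?_⟩,
    hΦ, hext⟩
  rw [hΦ, HL0.postcomp_apply, ← hΛ, Λ.apply_symm_apply]
  rfl

/-- Testing the property on `Y = G` is barred when `G` lies in another universe, so `G` is recovered
from its dual `HL0 X ℂ` by transposition. -/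
theorem Linearizes.existsUnique_equiv {X : Type u} [NormedAddCommGroup X]
    [NormedSpace ℂ X] {G : Type w} [NormedAddCommGroup G] [NormedSpace ℂ G] [CompleteSpace G]
    {d : B X → G} (hd : Linearizes.{u, w, v} d) :
    ∃! e : G0 X ≃ₗᵢ[ℂ] G, ∀ x, e (delta x) = d x := by
  obtain ⟨Λ, hΛ, hext⟩ := hd.exists_scalar
  have hdense : (Submodule.span ℂ (Set.range d)).topologicalClosure = ⊤ := by
    refine (Submodule.eq_top_iff'.2 fun g => by_contra fun hg => ?_)
    obtain ⟨T, u, hT, hu⟩ := RCLike.geometric_hahn_banach_closed_point (𝕜 := ℂ)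
      ((Submodule.span ℂ (Set.range d)).topologicalClosure.restrictScalars ℝ).convex
      (Submodule.isClosed_topologicalClosure _) hg
    have h0 : T = 0 := hext T 0 fun x => by
      -- If `T (d x) ≠ 0`, rescaling `d x` makes `T` take the value `u` on the subspace, where its
      -- real part is below `u`. So `T = 0`, and then `0 < u < 0`.
      by_contra hx
      have h := hT ((u / T (d x) : ℂ) • d x) (Submodule.smul_mem _ _
        (Submodule.le_topologicalClosure _ (Submodule.subset_span (Set.mem_range_self x))))
      rw [map_smul, smul_eq_mul, div_mul_cancel₀ _ hx] at h
      exact lt_irrefl u h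
    have h1 := hT 0 (zero_mem _)
    simp only [h0, _root_.zero_apply, map_zero] at h1 hu
    exact lt_asymm h1 hu
  -- The canonical embedding in the bidual followed by the transpose of `Λ`: `Φ g f = Λ f g`.
  let Φ : G →ₗᵢ[ℂ] StrongDual ℂ (HL0 X ℂ) :=
    { toFun := fun g => (NormedSpace.inclusionInDoubleDualLi ℂ g).comp
        Λ.toContinuousLinearEquiv.toContinuousLinearMap
      map_add' := fun g h => by rw [map_add, ContinuousLinearMap.add_comp]
      map_smul' := fun c g => by rw [map_smul, ContinuousLinearMap.smul_comp]; rfl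
      norm_map' := fun g => by
        rw [← (NormedSpace.inclusionInDoubleDualLi ℂ (E := G)).norm_map g]
        exact ContinuousLinearMap.opNorm_comp_linearIsometryEquiv _ Λ }
  have hΦd : ∀ x, Φ (d x) = evalAt x := fun x => by ext f; exact hΛ f x
  have hmem : ∀ g, Φ g ∈ G0Submodule X := fun g => by
    have hg : g ∈ (Submodule.span ℂ (Set.range d)).topologicalClosure := hdense ▸ trivial
    refine Submodule.topologicalClosure_minimal _
      (t := (G0Submodule X).comap Φ.toLinearMap) (Submodule.span_le.2 ?_)
      (isClosed_G0Submodule.preimage Φ.continuous) hg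
    rintro _ ⟨x, rfl⟩
    change Φ (d x) ∈ G0Submodule X
    exact (hΦd x).symm ▸ evalAt_mem x
  let Ψ : G →ₗᵢ[ℂ] G0 X :=
    { toLinearMap := Φ.toLinearMap.codRestrict (G0Submodule X) hmem
      norm_map' := Φ.norm_map }
  have hΨd : ∀ x, Ψ (d x) = delta x := fun x => Subtype.ext (hΦd x)
  have hsurj : Function.Surjective Ψ := fun φ =>
    G0.induction (LinearMap.range Ψ.toLinearMap) Ψ.isometry.isClosedEmbedding.isClosed_range
      (fun x => ⟨d x, hΨd x⟩) φ
  let e := LinearIsometryEquiv.ofSurjective Ψ hsurj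
  have he : ∀ x, e.symm (delta x) = d x := fun x => e.symm_apply_eq.2 (hΨd x).symm
  refine ⟨e.symm, he, fun e' he' => LinearIsometryEquiv.ext fun φ => ?_⟩
  exact DFunLike.congr_fun (ext_delta (T := e'.toContinuousLinearEquiv.toContinuousLinearMap)
    (S := e.symm.toContinuousLinearEquiv.toContinuousLinearMap)
    fun x => (he' x).trans (he x).symm) φ

theorem tendsto_pairing_iff {ι : Type*} {l : Filter ι} {f : ι → HL0 X ℂ} {g : HL0 X ℂ}
    (hf : ∃ C : ℝ, ∀ i, ‖f i‖ ≤ C) :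
    Tendsto (fun i => StrongDual.toWeakDual (pairing (f i))) l
        (𝓝 (StrongDual.toWeakDual (pairing g))) ↔
      ∀ x : B X, Tendsto (fun i => f i x) l (𝓝 (g x)) := by
  rw [tendsto_iff_forall_eval_tendsto_topDualPairing]
  change (∀ φ : G0 X, Tendsto (fun i => G0.incl φ (f i)) l (𝓝 (G0.incl φ g))) ↔ _
  refine ⟨fun h x => h (delta x), fun h φ => ?_⟩
  obtain ⟨C, hC⟩ := hf
  -- The functionals along which convergence holds form a subspace, closed because the family is
  -- bounded; it contains the evaluations.
  let M : Submodule ℂ (G0 X) :=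
    { carrier := {φ | Tendsto (fun i => G0.incl φ (f i)) l (𝓝 (G0.incl φ g))}
      zero_mem' := tendsto_const_nhds
      add_mem' := fun hφ hψ => hφ.add hψ
      smul_mem' := fun c _ hφ => hφ.const_smul c }
  refine G0.induction M (isClosed_of_closure_subset fun φ hφ => ?_) h φ
  refine Metric.tendsto_nhds.2 fun ε hε => ?_
  have hD : 0 < |C| + ‖g‖ + 1 := by positivity
  -- `|C| + ‖g‖` bounds `‖f i - g‖`, and the `+ 1` keeps the denominator positive; replacing `φ` by
  -- `ψ` then costs less than `ε / 2`.
  obtain ⟨ψ, hψ, hφψ⟩ := Metric.mem_closure_iff.1 hφ (ε / (2 * (|C| + ‖g‖ + 1))) (by positivity)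
  filter_upwards [Metric.tendsto_nhds.1 hψ (ε / 2) (half_pos hε)] with i hi
  rw [dist_eq_norm] at hi hφψ ⊢
  have h1 : ‖G0.incl (φ - ψ) (f i - g)‖ ≤ ‖φ - ψ‖ * (|C| + ‖g‖ + 1) := by
    refine (G0.incl (φ - ψ)).le_of_opNorm_le_of_le (G0.incl.norm_map _).le ?_
    linarith [norm_sub_le (f i) g, (hC i).trans (le_abs_self C)]
  have h2 : ‖φ - ψ‖ * (|C| + ‖g‖ + 1) < ε / 2 := by
    refine (mul_lt_mul_of_pos_right hφψ hD).trans_eq ?_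
    field_simp
  have h3 : G0.incl φ (f i) - G0.incl φ g =
      G0.incl (φ - ψ) (f i - g) + (G0.incl ψ (f i) - G0.incl ψ g) := by
    simp only [map_sub, _root_.sub_apply]
    ring
  rw [h3]
  linarith [norm_add_le (G0.incl (φ - ψ) (f i - g)) (G0.incl ψ (f i) - G0.incl ψ g)]

end

end HolLip

end

theorem mainTheorem3 (X : Type u) [NormedAddCommGroup X] [NormedSpace ℂ X]
    [CompleteSpace X] :
    -- `G₀(B_X)` is a Banach space, and `HL₀(B_X)` is its dual under `⟨f, φ⟩ = φ f`
    (CompleteSpace (HolLip.G0 X) ∧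
      ∃ J : HolLip.HL0 X ℂ ≃ₗᵢ[ℂ] StrongDual ℂ (HolLip.G0 X),
        ∀ f : HolLip.HL0 X ℂ, J f = HolLip.pairing f) ∧
    -- (a)
    (HolLip.IsHolomorphic (HolLip.delta : HolLip.B X → HolLip.G0 X) ∧
      (∀ x y : HolLip.B X, ‖HolLip.delta x - HolLip.delta y‖ = ‖(x : X) - (y : X)‖) ∧
      ∃ D : HolLip.HL0 X (HolLip.G0 X),
        (∀ x, D x = HolLip.delta x) ∧ (Nontrivial X → ‖D‖ = 1)) ∧
    -- (b)
    (HolLip.G0Submodule X =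
      (Submodule.span ℂ (Set.range (HolLip.evalAt : HolLip.B X →
        StrongDual ℂ (HolLip.HL0 X ℂ)))).topologicalClosure) ∧
    -- (c)
    (HolLip.Linearizes.{u, u, v} (HolLip.delta : HolLip.B X → HolLip.G0 X) ∧
      ∀ (G : Type w) [NormedAddCommGroup G] [NormedSpace ℂ G] [CompleteSpace G]
        (d : HolLip.B X → G), HolLip.Linearizes.{u, w, v} d →
          ∃! e : HolLip.G0 X ≃ₗᵢ[ℂ] G, ∀ x, e (HolLip.delta x) = d x) ∧
    -- (d)
    (∀ (ι : Type t) [Preorder ι] [IsDirectedOrder ι] [Nonempty ι]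
      (f : ι → HolLip.HL0 X ℂ) (g : HolLip.HL0 X ℂ), (∃ C : ℝ, ∀ i, ‖f i‖ ≤ C) →
        (Filter.Tendsto (fun i => StrongDual.toWeakDual (HolLip.pairing (f i))) Filter.atTop
            (nhds (StrongDual.toWeakDual (HolLip.pairing g))) ↔
          ∀ x : HolLip.B X, Filter.Tendsto (fun i => f i x) Filter.atTop (nhds (g x)))) := by
  refine ⟨⟨inferInstance, (HolLip.linearizationEquiv X ℂ).symm,
    HolLip.linearizationEquiv_symm_eq_pairing⟩,
    ⟨HolLip.isHolomorphic_delta, HolLip.norm_delta_sub, HolLip.HL0.delta, fun _ => rfl,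
      fun _ => HolLip.HL0.norm_delta⟩,
    HolLip.G0Submodule_eq_topologicalClosure,
    ⟨HolLip.linearizes_delta, fun G _ _ _ d hd => hd.existsUnique_equiv⟩,
    fun ι _ _ _ f g hf => HolLip.tendsto_pairing_iff hf⟩
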